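/- Let $\mathbb{K}$ be a field of characteristic zero, $S=\mathbb{K}[x_0,x_1,x_2,x_3]$ and $\alpha_{ij}=x_i-x_j$. Let $\mathbf{m}$ assign to each edge $\{i,j\}$ of the complete graph $K_4$ on the vertices $0,1,2,3$ a non-negative integer $m_{ij}=m_{ji}$. Let $$D(A_3,\mathbf{m})=\{\theta\in\mathrm{Der}_{\mathbb{K}}(S):\ \theta(\alpha_{ij})\in\langle\alpha_{ij}^{m_{ij}}\rangle\ \text{for all } 0\le i<j\le 3\},$$ and let $J(0123)\subset S$ be the ideal generated by the six powers $\alpha_{ij}^{m_{ij}}$, $0\le i<j\le 3$. A vertex $i$ is called a free vertex of $\mathbf{m}$ if $m_{ij}+m_{ik}\le m_{jk}+1$ for all distinct $j,k\in\{0,1,2,3\}\setminus\{i\}$; with $(m_{01},m_{02},m_{03},m_{12},m_{13},m_{23})=(a,b,c,d,e,f)$, the vertex $0$ is free if and only if $a+b\le d+1$, $a+c\le e+1$ and $b+c\le f+1$. 1. If, for some vertex $i$, the ideal $J(0123)$ is minimally generated by the three powers $\alpha_{ij}^{m_{ij}}$, $j\ne i$, on the edges at $i$ (they generate $J(0123)$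 and no proper subfamily of them does), then $D(A_3,\mathbf{m})$ is a free $S$-module. 2. If $\mathbf{m}$ has a free vertex, then $D(A_3,\mathbf{m})$ is a free $S$-module. 3. If all $m_{ij}$ are positive, then for every vertex $i$ the ideal $J(0123)$ is minimally generated by the three powers on the edges at $i$ if and only if $i$ is a free vertex of $\mathbf{m}$. -/

import Mathlib

/-- The polynomial ring `S = K[x₀, x₁, x₂, x₃]`. -/
abbrev PolyS (K : Type*) [Field K] : Type _ := MvPolynomial (Fin 4) K

/-- The linear form `α_{ij} = x_i - x_j`, whose kernel is the hyperplane `H_{ij}`. -/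
noncomputable def braidForm (K : Type*) [Field K] (i j : Fin 4) : PolyS K :=
  MvPolynomial.X i - MvPolynomial.X j

/-- The module `D(A₃, m)` of logarithmic derivations of the multi-braid arrangement: all
`K`-derivations `θ` of `S` such that `θ(α_{ij})` lies in the ideal `⟨α_{ij} ^ m_{ij}⟩`
for all `i < j`. A multiplicity is a labelling `m` of the edges `{i, j}` of `K₄`; the values of
`m` on the diagonal `s(i, i)` are never used. -/
noncomputable def logDerivations (K : Type*) [Field K] (m : Sym2 (Fin 4) → ℕ) :
    Submodule (PolyS K) (Derivation K (PolyS K) (PolyS K)) where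
  carrier := {θ | ∀ i j : Fin 4, i < j →
    θ (braidForm K i j) ∈ Ideal.span {braidForm K i j ^ m s(i, j)}}
  add_mem' := by
    intro θ η hθ hη i j hij
    rw [Derivation.add_apply]
    exact Ideal.add_mem _ (hθ i j hij) (hη i j hij)
  zero_mem' := by
    intro i j _
    rw [Derivation.zero_apply]
    exact Ideal.zero_mem _
  smul_mem' := by
    intro c θ hθ i j hij
    rw [Derivation.smul_apply]
    exact Ideal.mul_mem_left _ c (hθ i j hij)

/-- The multiplicity `m` is free: `D(A₃, m)` is a free `S`-module. -/
def IsFreeMultiplicity (K : Type*) [Field K] (m : Sym2 (Fin 4) → ℕ) : Prop :=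
  Module.Free (PolyS K) (logDerivations K m)

/-- The ideal of `S` generated by the powers `α_{ij} ^ m_{ij}` for the edges `{i, j}` of `K₄`
that belong to the set `E`. -/
noncomputable def powerIdeal (K : Type*) [Field K] (m : Sym2 (Fin 4) → ℕ)
    (E : Set (Sym2 (Fin 4))) : Ideal (PolyS K) :=
  Ideal.span {p | ∃ i j : Fin 4, i < j ∧ s(i, j) ∈ E ∧ p = braidForm K i j ^ m s(i, j)}

/-- The ideal `J(0123)`, generated by all six powers `α_{ij} ^ m_{ij}`. -/
noncomputable def idealJ0123 (K : Type*) [Field K] (m : Sym2 (Fin 4) → ℕ) : Ideal (PolyS K) :=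
  powerIdeal K m (⊤ : SimpleGraph (Fin 4)).edgeSet

/-- The ideal `J(0123)` is minimally generated by the powers `α_{ij} ^ m_{ij}` on the three edges
of `K₄` at the vertex `i`: they generate it, and no proper subfamily of them does. -/
def IsMinimallyGeneratedAt (K : Type*) [Field K] (m : Sym2 (Fin 4) → ℕ) (i : Fin 4) : Prop :=
  Minimal (fun E : Set (Sym2 (Fin 4)) => powerIdeal K m E = idealJ0123 K m)
    ((⊤ : SimpleGraph (Fin 4)).incidenceSet i)

/-- The vertex `i` is a free vertex of `m`: `m_{jk} ≥ m_{ij} + m_{ik} - 1` for all distinct `j`, `k`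
different from `i`. -/
def IsFreeVertex (m : Sym2 (Fin 4) → ℕ) (i : Fin 4) : Prop :=
  ∀ j k : Fin 4, j ≠ i → k ≠ i → j ≠ k → m s(i, j) + m s(i, k) ≤ m s(j, k) + 1

/-! Let `i` be a free vertex and `j`, `k`, `l` the others. Sending `θ` to its differences along `jk`
and `kl` maps `D(A₃, m)` to the module of pairs `(p, q)` attached to the triangle `jkl`. That module
involves only binary forms, hence is free of rank two (`IsSyzygyBasis.exists_basis`). The map is
onto: the free-vertex inequalities put each triangle power in the ideal of two powers at `i`
(`braidForm_pow_mem_span_pair`), so a three-term Chinese remainder argument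
(`exists_dvd_sub_of_pairwise_mem_span`) lifts every pair. Its kernel, the derivations equal on
`x_j`, `x_k`, `x_l`, is free on two obvious elements, so four generators form a basis.

Minimal generation reduces to this. Minimality forces positive exponents at `i`, and specialising to
two variables turns generation into the inequalities. Characteristic zero is needed only there, to
make a binomial coefficient nonzero. -/

/-! ### Rank two: bases for a triangle of powers -/

section RankTwo

variable (K : Type*) [Field K] {S : Type*} [CommRing S] [Algebra K S]

/-- `r` is a binary form of degree `e` over `K` in `X` and `Z`. -/
def IsBinaryForm (X Z : S) : ℕ → S → Prop
  | 0, r => ∃ s : K, r = algebraMap K S s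
  | e + 1, r => ∃ (s : K) (r' : S), IsBinaryForm X Z e r' ∧ r = algebraMap K S s * X ^ (e + 1) + Z * r'

variable {K} {X Z : S}

namespace IsBinaryForm

theorem zero (e : ℕ) : IsBinaryForm K X Z e 0 := by
  induction e with
  | zero => exact ⟨0, by simp⟩
  | succ e ih => exact ⟨0, 0, ih, by simp⟩

theorem add {e : ℕ} {r t : S} (hr : IsBinaryForm K X Z e r) (ht : IsBinaryForm K X Z e t) :
    IsBinaryForm K X Z e (r + t) := by
  induction e generalizing r t with
  | zero =>
    obtain ⟨a, rfl⟩ := hr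
    obtain ⟨b, rfl⟩ := ht
    exact ⟨a + b, by simp⟩
  | succ e ih =>
    obtain ⟨a, r', hr', rfl⟩ := hr
    obtain ⟨b, t', ht', rfl⟩ := ht
    exact ⟨a + b, r' + t', ih hr' ht', by rw [map_add]; ring⟩

theorem algebraMap_mul {e : ℕ} {r : S} (a : K) (hr : IsBinaryForm K X Z e r) :
    IsBinaryForm K X Z e (algebraMap K S a * r) := by
  induction e generalizing r with
  | zero =>
    obtain ⟨b, rfl⟩ := hr
    exact ⟨a * b, by simp⟩
  | succ e ih =>
    obtain ⟨b, r', hr', rfl⟩ := hr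
    exact ⟨a * b, _, ih hr', by rw [map_mul]; ring⟩

theorem right_mul {e : ℕ} {r : S} (hr : IsBinaryForm K X Z e r) :
    IsBinaryForm K X Z (e + 1) (Z * r) :=
  ⟨0, r, hr, by simp⟩

theorem left_mul {e : ℕ} {r : S} (hr : IsBinaryForm K X Z e r) :
    IsBinaryForm K X Z (e + 1) (X * r) := by
  induction e generalizing r with
  | zero =>
    obtain ⟨b, rfl⟩ := hr
    exact ⟨b, 0, zero 0, by ring⟩
  | succ e ih =>
    obtain ⟨b, r', hr', rfl⟩ := hr
    exact ⟨b, _, ih hr', by ring⟩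

theorem left_pow_mul {e : ℕ} {r : S} (n : ℕ) (hr : IsBinaryForm K X Z e r) :
    IsBinaryForm K X Z (e + n) (X ^ n * r) := by
  induction n with
  | zero => simpa using hr
  | succ n ih =>
    rw [pow_succ', mul_assoc]
    exact ih.left_mul

theorem left_pow (n : ℕ) : IsBinaryForm K X Z n (X ^ n) := by
  simpa using left_pow_mul n (show IsBinaryForm K X Z 0 (1 : S) from ⟨1, by simp⟩)

theorem sub_pow (n : ℕ) : IsBinaryForm K X Z n ((Z - X) ^ n) := by
  induction n with
  | zero => exact ⟨1, by simp⟩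
  | succ n ih =>
    have h := ih.right_mul.add (ih.left_mul.algebraMap_mul (-1))
    convert h using 1
    rw [map_neg, map_one]
    ring

/-- Modulo `Z`, a binary form of degree `e` is a multiple of `X ^ e`. -/
theorem exists_dvd_sub {e : ℕ} {r : S} (hr : IsBinaryForm K X Z e r) :
    ∃ s : K, Z ∣ r - algebraMap K S s * X ^ e := by
  cases e with
  | zero =>
    obtain ⟨s, rfl⟩ := hr
    exact ⟨s, by simp⟩
  | succ e =>
    obtain ⟨s, r', -, rfl⟩ := hr
    exact ⟨s, r', by ring⟩

theorem not_dvd_algebraMap_mul_pow (hZ : Prime Z) (hX : ¬ Z ∣ X) {s : K} (hs : s ≠ 0) (n : ℕ) :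
    ¬ Z ∣ algebraMap K S s * X ^ n := by
  intro h
  rcases hZ.dvd_or_dvd h with h | h
  · exact hZ.not_isUnit (isUnit_of_dvd_unit h ((IsUnit.mk0 s hs).map (algebraMap K S)))
  · exact hX (hZ.dvd_of_dvd_pow h)

/-- Divisibility by `Z` kills the pure `X` term. In degree zero this leaves only `r = 0`, where the
degree of the quotient is set to `0`. -/
theorem exists_eq_mul (hZ : Prime Z) (hX : ¬ Z ∣ X) {e : ℕ} {r : S}
    (hr : IsBinaryForm K X Z e r) (h : Z ∣ r) :
    ∃ (e' : ℕ) (r' : S), IsBinaryForm K X Z e' r' ∧ r = Z * r' := by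
  cases e with
  | zero =>
    obtain ⟨s, rfl⟩ := hr
    by_cases hs : s = 0
    · exact ⟨0, 0, zero 0, by simp [hs]⟩
    · exact absurd (by simpa using h) (not_dvd_algebraMap_mul_pow hZ hX hs 0)
  | succ e =>
    obtain ⟨s, r', hr', rfl⟩ := hr
    by_cases hs : s = 0
    · exact ⟨e, r', hr', by simp [hs]⟩
    · exact absurd ((dvd_add_left (dvd_mul_right Z r')).mp h)
        (not_dvd_algebraMap_mul_pow hZ hX hs _)

end IsBinaryForm

variable (K X Z) in
/-- `θ₁, θ₂` is a basis of the module of all pairs `(p, q)` with `A ∣ p`, `B ∣ q` and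
`Z ^ c ∣ p + q`, and the quotients of `p + q` by `Z ^ c` for the basis elements are the
binary forms `r₁, r₂` of degrees `e₁, e₂`. -/
structure IsSyzygyBasis (A B : S) (c : ℕ) (θ₁ θ₂ : S × S) (e₁ e₂ : ℕ) (r₁ r₂ : S) : Prop where
  form₁ : IsBinaryForm K X Z e₁ r₁
  form₂ : IsBinaryForm K X Z e₂ r₂
  dvd₁ : A ∣ θ₁.1 ∧ B ∣ θ₁.2
  dvd₂ : A ∣ θ₂.1 ∧ B ∣ θ₂.2
  sum₁ : θ₁.1 + θ₁.2 = Z ^ c * r₁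
  sum₂ : θ₂.1 + θ₂.2 = Z ^ c * r₂
  indep : ∀ x y : S, x • θ₁ + y • θ₂ = 0 → x = 0 ∧ y = 0
  span : ∀ v : S × S, A ∣ v.1 → B ∣ v.2 → Z ^ c ∣ v.1 + v.2 → ∃ x y : S, v = x • θ₁ + y • θ₂

namespace IsSyzygyBasis

variable {A B : S} {c : ℕ} {θ₁ θ₂ : S × S} {e₁ e₂ : ℕ} {r₁ r₂ : S}

theorem swap (h : IsSyzygyBasis K X Z A B c θ₁ θ₂ e₁ e₂ r₁ r₂) :
    IsSyzygyBasis K X Z A B c θ₂ θ₁ e₂ e₁ r₂ r₁ where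
  form₁ := h.form₂
  form₂ := h.form₁
  dvd₁ := h.dvd₂
  dvd₂ := h.dvd₁
  sum₁ := h.sum₂
  sum₂ := h.sum₁
  indep x y hxy := (h.indep y x (by rw [add_comm, hxy])).symm
  span v h₁ h₂ h₃ := by
    obtain ⟨x, y, rfl⟩ := h.span v h₁ h₂ h₃
    exact ⟨y, x, add_comm _ _⟩

/-- Raising `c` by one costs a single linear condition modulo `Z` on the coordinates. -/
theorem span_succ [IsDomain S] (hZ : Prime Z) (h : IsSyzygyBasis K X Z A B c θ₁ θ₂ e₁ e₂ r₁ r₂)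
    (v : S × S) (h₁ : A ∣ v.1) (h₂ : B ∣ v.2) (h₃ : Z ^ (c + 1) ∣ v.1 + v.2) :
    ∃ x y : S, v = x • θ₁ + y • θ₂ ∧ Z ∣ x * r₁ + y * r₂ := by
  obtain ⟨x, y, rfl⟩ := h.span v h₁ h₂ ((pow_dvd_pow Z c.le_succ).trans h₃)
  refine ⟨x, y, rfl, ?_⟩
  have e : (x • θ₁ + y • θ₂).1 + (x • θ₁ + y • θ₂).2 = Z ^ c * (x * r₁ + y * r₂) := by
    simp only [Prod.fst_add, Prod.snd_add, Prod.smul_fst, Prod.smul_snd, smul_eq_mul]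
    linear_combination x * h.sum₁ + y * h.sum₂
  rw [e, pow_succ] at h₃
  exact (mul_dvd_mul_iff_left (pow_ne_zero c hZ.ne_zero)).mp h₃

/-- If `Z ∣ r₁`, then `θ₁` stays in the basis, and `θ₂` either stays or is multiplied by `Z`. -/
theorem succ_of_dvd [IsDomain S] (hZ : Prime Z) (hX : ¬ Z ∣ X)
    (h : IsSyzygyBasis K X Z A B c θ₁ θ₂ e₁ e₂ r₁ r₂) (hr : Z ∣ r₁) :
    ∃ θ₁ θ₂ e₁ e₂ r₁ r₂, IsSyzygyBasis K X Z A B (c + 1) θ₁ θ₂ e₁ e₂ r₁ r₂ := by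
  obtain ⟨d₁, t₁, ht₁, rfl⟩ := h.form₁.exists_eq_mul hZ hX hr
  by_cases hr₂ : Z ∣ r₂
  · obtain ⟨d₂, t₂, ht₂, rfl⟩ := h.form₂.exists_eq_mul hZ hX hr₂
    exact ⟨θ₁, θ₂, d₁, d₂, t₁, t₂, ht₁, ht₂, h.dvd₁, h.dvd₂, by rw [h.sum₁]; ring,
      by rw [h.sum₂]; ring, h.indep,
      fun v h₁ h₂ h₃ => h.span v h₁ h₂ ((pow_dvd_pow Z c.le_succ).trans h₃)⟩
  · refine ⟨θ₁, Z • θ₂, d₁, e₂, t₁, r₂, ht₁, h.form₂, h.dvd₁,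
      ⟨h.dvd₂.1.mul_left Z, h.dvd₂.2.mul_left Z⟩, by rw [h.sum₁]; ring, ?_, ?_, ?_⟩
    · simp only [Prod.smul_fst, Prod.smul_snd, smul_eq_mul]
      linear_combination Z * h.sum₂
    · intro x y hxy
      rw [smul_smul] at hxy
      obtain ⟨hx, hy⟩ := h.indep _ _ hxy
      exact ⟨hx, (mul_eq_zero.mp hy).resolve_right hZ.ne_zero⟩
    · intro v h₁ h₂ h₃
      obtain ⟨x, y, rfl, hxy⟩ := h.span_succ hZ v h₁ h₂ h₃
      have hy : Z ∣ y * r₂ := (dvd_add_right (hr.mul_left x)).mp hxy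
      obtain ⟨w, rfl⟩ := (hZ.dvd_or_dvd hy).resolve_right hr₂
      exact ⟨x, w, by rw [smul_smul, mul_comm w]⟩

/-- Modulo `Z` the quotients are `s₁ X ^ e₁` and `s₂ X ^ e₂`. As `e₁ ≤ e₂`, a multiple of `θ₁`
cancels the residue of `r₂`, while `θ₁` itself is multiplied by `Z` if `Z ∤ r₁`. -/
theorem succ_of_le [IsDomain S] (hZ : Prime Z) (hX : ¬ Z ∣ X)
    (h : IsSyzygyBasis K X Z A B c θ₁ θ₂ e₁ e₂ r₁ r₂) (he : e₁ ≤ e₂) :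
    ∃ θ₁ θ₂ e₁ e₂ r₁ r₂, IsSyzygyBasis K X Z A B (c + 1) θ₁ θ₂ e₁ e₂ r₁ r₂ := by
  by_cases hr₁ : Z ∣ r₁
  · exact h.succ_of_dvd hZ hX hr₁
  obtain ⟨s₁, hs₁⟩ := h.form₁.exists_dvd_sub
  obtain ⟨s₂, hs₂⟩ := h.form₂.exists_dvd_sub
  have hs : s₁ ≠ 0 := by
    rintro rfl
    exact hr₁ (by simpa using hs₁)
  obtain ⟨n, rfl⟩ := Nat.exists_eq_add_of_le he
  set u : S := algebraMap K S (-(s₂ / s₁)) with hu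
  have hform := h.form₂.add ((h.form₁.left_pow_mul n).algebraMap_mul (-(s₂ / s₁)))
  rw [← hu] at hform
  have hus : u * algebraMap K S s₁ = -algebraMap K S s₂ := by
    rw [hu, ← map_mul, ← map_neg]
    congr 1
    field_simp
  have hdvd : Z ∣ r₂ + u * (X ^ n * r₁) := by
    obtain ⟨w₁, hw₁⟩ := hs₁
    obtain ⟨w₂, hw₂⟩ := hs₂
    refine ⟨w₂ + u * X ^ n * w₁, ?_⟩
    linear_combination hw₂ + u * X ^ n * hw₁ + X ^ (e₁ + n) * hus
  obtain ⟨d, t, ht, htr⟩ := hform.exists_eq_mul hZ hX hdvd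
  refine ⟨Z • θ₁, θ₂ + (u * X ^ n) • θ₁, e₁, d, r₁, t, h.form₁, ht,
    ⟨h.dvd₁.1.mul_left Z, h.dvd₁.2.mul_left Z⟩,
    ⟨dvd_add h.dvd₂.1 (h.dvd₁.1.mul_left _), dvd_add h.dvd₂.2 (h.dvd₁.2.mul_left _)⟩, ?_, ?_, ?_, ?_⟩
  · simp only [Prod.smul_fst, Prod.smul_snd, smul_eq_mul]
    linear_combination Z * h.sum₁
  · simp only [Prod.fst_add, Prod.snd_add, Prod.smul_fst, Prod.smul_snd, smul_eq_mul]
    linear_combination h.sum₂ + u * X ^ n * h.sum₁ + Z ^ c * htr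
  · intro x y hxy
    obtain ⟨hx, rfl⟩ := h.indep (x * Z + y * (u * X ^ n)) y (by rw [← hxy]; module)
    rw [zero_mul, add_zero] at hx
    exact ⟨(mul_eq_zero.mp hx).resolve_right hZ.ne_zero, rfl⟩
  · intro v h₁ h₂ h₃
    obtain ⟨x, y, rfl, hxy⟩ := h.span_succ hZ v h₁ h₂ h₃
    -- Since `r₂ ≡ -u X ^ n r₁` modulo `Z`, the condition on `x`, `y` becomes one on a multiple of
    -- `r₁`, and `Z ∤ r₁`.
    have hx : Z ∣ (x - y * (u * X ^ n)) * r₁ := by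
      have e : (x - y * (u * X ^ n)) * r₁ = x * r₁ + y * r₂ - y * (r₂ + u * (X ^ n * r₁)) := by ring
      rw [e]
      exact dvd_sub hxy (hdvd.mul_left y)
    obtain ⟨w, hw⟩ := (hZ.dvd_or_dvd hx).resolve_right hr₁
    refine ⟨w, y, ?_⟩
    rw [sub_eq_iff_eq_add.mp hw]
    module

theorem exists_basis [IsDomain S] (hZ : Prime Z) (hX : ¬ Z ∣ X) (hA : A ≠ 0) (hB : B ≠ 0)
    {a b : ℕ} (hA' : IsBinaryForm K X Z a A) (hB' : IsBinaryForm K X Z b B) (c : ℕ) :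
    ∃ θ₁ θ₂ e₁ e₂ r₁ r₂, IsSyzygyBasis K X Z A B c θ₁ θ₂ e₁ e₂ r₁ r₂ := by
  induction c with
  | zero =>
    refine ⟨(A, 0), (0, B), a, b, A, B, hA', hB', by simp, by simp, by simp, by simp, ?_, ?_⟩
    · intro x y hxy
      simpa [Prod.ext_iff, hA, hB] using hxy
    · rintro ⟨-, -⟩ ⟨x, rfl⟩ ⟨y, rfl⟩ -
      exact ⟨x, y, by simp [mul_comm]⟩
  | succ c ih =>
    obtain ⟨θ₁, θ₂, e₁, e₂, r₁, r₂, h⟩ := ih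
    rcases le_total e₁ e₂ with he | he
    · exact h.succ_of_le hZ hX he
    · exact h.swap.succ_of_le hZ hX he

end IsSyzygyBasis

end RankTwo

/-! ### Divisibility by the linear forms -/

section BraidForm

open MvPolynomial

variable {K : Type*} [Field K]

theorem braidForm_swap (i j : Fin 4) : braidForm K j i = -braidForm K i j := by
  simp [braidForm]

theorem associated_braidForm_pow_swap (i j : Fin 4) (n : ℕ) :
    Associated (braidForm K j i ^ n) (braidForm K i j ^ n) := by
  rw [braidForm_swap]
  exact (Associated.refl _).neg_left.pow_pow

variable (K) in
/-- The retraction of `S` that sends `x_i` to `x_j`; its kernel is generated by `α_{ij}`. -/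
noncomputable def collapse (i j : Fin 4) : PolyS K →ₐ[K] PolyS K :=
  aeval fun k => if k = i then X j else X k

theorem collapse_X_self (i j : Fin 4) : collapse K i j (X i) = X j := by
  simp [collapse]

theorem collapse_X_of_ne {i k : Fin 4} (h : k ≠ i) (j : Fin 4) :
    collapse K i j (X k) = X k := by
  simp [collapse, h]

theorem collapse_braidForm_self (i j : Fin 4) : collapse K i j (braidForm K i j) = 0 := by
  rw [braidForm, map_sub, collapse_X_self]
  by_cases h : j = i
  · rw [h, collapse_X_self, sub_self]
  · rw [collapse_X_of_ne h, sub_self]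

theorem collapse_braidForm_of_ne {i k l : Fin 4} (hk : k ≠ i) (hl : l ≠ i) (j : Fin 4) :
    collapse K i j (braidForm K k l) = braidForm K k l := by
  rw [braidForm, map_sub, collapse_X_of_ne hk, collapse_X_of_ne hl]

/-- Modulo `α_{ij}`, the retraction and the identity agree on variables, hence everywhere. -/
theorem braidForm_dvd_sub_collapse (i j : Fin 4) (p : PolyS K) :
    braidForm K i j ∣ p - collapse K i j p := by
  rw [← Ideal.mem_span_singleton, ← Ideal.Quotient.eq]
  have h : (Ideal.Quotient.mkₐ K (Ideal.span {braidForm K i j})) =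
      (Ideal.Quotient.mkₐ K (Ideal.span {braidForm K i j})).comp (collapse K i j) := by
    ext k
    simp only [AlgHom.comp_apply]
    by_cases hk : k = i
    · subst hk
      rw [collapse_X_self, Ideal.Quotient.mkₐ_eq_mk, Ideal.Quotient.eq]
      exact Ideal.mem_span_singleton_self _
    · rw [collapse_X_of_ne hk]
  exact DFunLike.congr_fun h p

theorem braidForm_dvd_iff {i j : Fin 4} {p : PolyS K} :
    braidForm K i j ∣ p ↔ collapse K i j p = 0 := by
  constructor
  · rintro ⟨q, rfl⟩
    rw [map_mul, collapse_braidForm_self, zero_mul]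
  · intro h
    simpa [h] using braidForm_dvd_sub_collapse i j p

theorem braidForm_ne_zero {i j : Fin 4} (h : i ≠ j) : braidForm K i j ≠ 0 :=
  sub_ne_zero.mpr fun e => h (X_injective e)

/-- The form generates the kernel of a map into a domain. -/
theorem prime_braidForm {i j : Fin 4} (h : i ≠ j) : Prime (braidForm K i j) := by
  refine ⟨braidForm_ne_zero h, fun hu => ?_, fun p q hpq => ?_⟩
  · have := hu.map (collapse K i j)
    rw [collapse_braidForm_self] at this
    exact not_isUnit_zero this
  · rw [braidForm_dvd_iff, map_mul, mul_eq_zero] at hpq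
    rwa [braidForm_dvd_iff, braidForm_dvd_iff]

theorem not_braidForm_dvd {i j k l : Fin 4} (hkl : k ≠ l) (hk : k ≠ i) (hl : l ≠ i) :
    ¬ braidForm K i j ∣ braidForm K k l := by
  rw [braidForm_dvd_iff, collapse_braidForm_of_ne hk hl]
  exact braidForm_ne_zero hkl

/-- `α_{ji}` is regular modulo an ideal generated by polynomials that do not involve `x_j`. -/
theorem mem_span_pair_of_braidForm_pow_mul_mem {i j : Fin 4} {p q : PolyS K}
    (hp : collapse K j i p = p) (hq : collapse K j i q = q) (n : ℕ) (w : PolyS K)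
    (hw : braidForm K j i ^ n * w ∈ Ideal.span {p, q}) (hij : j ≠ i) : w ∈ Ideal.span {p, q} := by
  induction n with
  | zero => simpa using hw
  | succ n ih =>
    refine ih ?_
    rw [Ideal.mem_span_pair] at hw ⊢
    obtain ⟨y, z, hyz⟩ := hw
    -- The retraction kills the left side and fixes `p`, `q`. Subtracting its image leaves
    -- coefficients divisible by the form, which then cancels.
    have h₀ := congrArg (collapse K j i) hyz
    rw [map_add, map_mul, map_mul, hp, hq, map_mul, map_pow, collapse_braidForm_self,
      zero_pow n.succ_ne_zero, zero_mul] at h₀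
    obtain ⟨y', hy⟩ := braidForm_dvd_sub_collapse j i y
    obtain ⟨z', hz⟩ := braidForm_dvd_sub_collapse j i z
    refine ⟨y', z', mul_left_cancel₀ (braidForm_ne_zero (K := K) hij) ?_⟩
    linear_combination hyz - p * hy - q * hz - h₀

end BraidForm

/-! ### Gluing congruences, and freeness from four generators -/

/-- The Chinese remainder theorem for three elements, under a regularity hypothesis in place of
comaximality. -/
theorem exists_dvd_sub_of_pairwise_mem_span {R : Type*} [CommRing R] {p q r : R}
    (hreg : ∀ w, p * w ∈ Ideal.span {q, r} → w ∈ Ideal.span {q, r}) {f g h : R}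
    (hfg : f - g ∈ Ideal.span {p, q}) (hfh : f - h ∈ Ideal.span {p, r})
    (hgh : g - h ∈ Ideal.span {q, r}) :
    ∃ c, p ∣ f - c ∧ q ∣ g - c ∧ r ∣ h - c := by
  simp only [Ideal.mem_span_pair] at *
  obtain ⟨a₁, b₁, e₁⟩ := hfg
  obtain ⟨a₂, b₂, e₂⟩ := hfh
  obtain ⟨a₃, b₃, e₃⟩ := hgh
  -- The three relations sum to `p (a₂ - a₁) ∈ ⟨q, r⟩`. The element `f - a₁ p` already works modulo
  -- `p` and `q`; a multiple of `p q` corrects it modulo `r`.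
  obtain ⟨a₄, b₄, e₄⟩ := hreg (a₂ - a₁) ⟨a₃ + b₁, b₃ - b₂, by linear_combination e₁ - e₂ + e₃⟩
  refine ⟨f - a₁ * p - a₄ * p * q, ⟨a₁ + a₄ * q, by ring⟩, ⟨-b₁ + a₄ * p, ?_⟩,
    ⟨-(b₂ + b₄ * p), ?_⟩⟩
  · linear_combination e₁
  · linear_combination e₂ + p * e₄

theorem Module.Free.of_four_generators {R M : Type*} [CommRing R] [AddCommGroup M] [Module R M]
    (v₀ v₁ v₂ v₃ : M)
    (hind : ∀ x y z w : R, x • v₀ + y • v₁ + z • v₂ + w • v₃ = 0 → x = 0 ∧ y = 0 ∧ z = 0 ∧ w = 0)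
    (hspan : ∀ v : M, ∃ x y z w : R, v = x • v₀ + y • v₁ + z • v₂ + w • v₃) :
    Module.Free R M := by
  refine Module.Free.of_basis (Module.Basis.mk (v := ![v₀, v₁, v₂, v₃]) ?_ ?_)
  · rw [Fintype.linearIndependent_iff]
    intro g hg
    obtain ⟨h₀, h₁, h₂, h₃⟩ := hind (g 0) (g 1) (g 2) (g 3) (by simpa [Fin.sum_univ_four] using hg)
    intro x
    fin_cases x
    exacts [h₀, h₁, h₂, h₃]
  · rintro v -
    obtain ⟨x, y, z, w, rfl⟩ := hspan v
    have hmem (n : Fin 4) : ![v₀, v₁, v₂, v₃] n ∈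
        Submodule.span R (Set.range ![v₀, v₁, v₂, v₃]) :=
      Submodule.subset_span ⟨n, rfl⟩
    exact add_mem (add_mem (add_mem (Submodule.smul_mem _ _ (hmem 0))
      (Submodule.smul_mem _ _ (hmem 1))) (Submodule.smul_mem _ _ (hmem 2)))
      (Submodule.smul_mem _ _ (hmem 3))

/-! ### Freeness at a free vertex -/

section Freeness

open MvPolynomial

variable {K : Type*} [Field K] {m : Sym2 (Fin 4) → ℕ}

theorem mem_logDerivations_iff {θ : Derivation K (PolyS K) (PolyS K)} :
    θ ∈ logDerivations K m ↔
      ∀ i j : Fin 4, i ≠ j → braidForm K i j ^ m s(i, j) ∣ θ (X i) - θ (X j) := by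
  have key : θ ∈ logDerivations K m ↔
      ∀ i j : Fin 4, i < j → braidForm K i j ^ m s(i, j) ∣ θ (X i) - θ (X j) := by
    simp only [← Ideal.mem_span_singleton, ← map_sub]
    rfl
  rw [key]
  refine ⟨fun h i j hij => ?_, fun h i j hij => h i j hij.ne⟩
  rcases lt_or_gt_of_ne hij with hlt | hlt
  · exact h i j hlt
  · have := h j i hlt
    rw [(associated_braidForm_pow_swap i j _).dvd_iff_dvd_left, ← dvd_neg, neg_sub, Sym2.eq_swap] at this
    exact this

/-- The orientations fit the triangle: the `jl` difference is the sum of the `jk` and `kl`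
differences, and edges at `i` point to `i`. -/
theorem mem_logDerivations_iff_of_forall_eq_or {i j k l : Fin 4} (hij : i ≠ j) (hik : i ≠ k)
    (hil : i ≠ l) (hjk : j ≠ k) (hjl : j ≠ l) (hkl : k ≠ l)
    (hall : ∀ x, x = i ∨ x = j ∨ x = k ∨ x = l) {θ : Derivation K (PolyS K) (PolyS K)} :
    θ ∈ logDerivations K m ↔
      braidForm K j i ^ m s(i, j) ∣ θ (X j) - θ (X i) ∧
      braidForm K k i ^ m s(i, k) ∣ θ (X k) - θ (X i) ∧
      braidForm K l i ^ m s(i, l) ∣ θ (X l) - θ (X i) ∧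
      braidForm K j k ^ m s(j, k) ∣ θ (X j) - θ (X k) ∧
      braidForm K k l ^ m s(k, l) ∣ θ (X k) - θ (X l) ∧
      braidForm K j l ^ m s(j, l) ∣ θ (X j) - θ (X l) := by
  rw [mem_logDerivations_iff]
  constructor
  · intro h
    refine ⟨?_, ?_, ?_, h _ _ hjk, h _ _ hkl, h _ _ hjl⟩
    · rw [Sym2.eq_swap]; exact h _ _ hij.symm
    · rw [Sym2.eq_swap]; exact h _ _ hik.symm
    · rw [Sym2.eq_swap]; exact h _ _ hil.symm
  · rintro ⟨h₁, h₂, h₃, h₄, h₅, h₆⟩ x y hxy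
    have hswap : ∀ {x y : Fin 4} {n : ℕ}, braidForm K x y ^ n ∣ θ (X x) - θ (X y) →
        braidForm K y x ^ n ∣ θ (X y) - θ (X x) := by
      intro x y n h
      rwa [(associated_braidForm_pow_swap x y n).dvd_iff_dvd_left, ← dvd_neg, neg_sub]
    rcases hall x with rfl | rfl | rfl | rfl <;> rcases hall y with rfl | rfl | rfl | rfl <;>
      first
        | exact absurd rfl hxy
        | assumption
        | (apply hswap; assumption)
        | (rw [Sym2.eq_swap]; assumption)
        | (rw [Sym2.eq_swap]; apply hswap; assumption)

/-- With `α_{jk} = α_{ji} - α_{ki}`, each term of the binomial expansion contains one of the two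
powers. -/
theorem braidForm_pow_mem_span_pair {i j k : Fin 4} {a b n : ℕ} (h : a + b ≤ n + 1) :
    braidForm K j k ^ n ∈ Ideal.span {braidForm K j i ^ a, braidForm K k i ^ b} := by
  have e : braidForm K j k = braidForm K j i + -braidForm K k i := by
    simp only [braidForm]; ring
  rw [e]
  refine Ideal.add_pow_mem_of_pow_mem_of_le _ (m := a) (n := b) ?_ ?_ h
  · exact Ideal.subset_span (by simp)
  · rw [neg_pow]
    exact Ideal.mul_mem_left _ _ (Ideal.subset_span (by simp))

theorem Fin.exists_complement_four (i : Fin 4) : ∃ j k l : Fin 4, i ≠ j ∧ i ≠ k ∧ i ≠ l ∧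
    j ≠ k ∧ j ≠ l ∧ k ≠ l ∧ ∀ x, x = i ∨ x = j ∨ x = k ∨ x = l := by
  revert i
  decide

theorem IsFreeVertex.isFreeMultiplicity {i : Fin 4} (h : IsFreeVertex m i) :
    IsFreeMultiplicity K m := by
  obtain ⟨j, k, l, hij, hik, hil, hjk, hjl, hkl, hall⟩ := i.exists_complement_four
  have hjk' := h j k hij.symm hik.symm hjk
  have hjl' := h j l hij.symm hil.symm hjl
  have hkl' := h k l hik.symm hil.symm hkl
  have hmem (θ) := mem_logDerivations_iff_of_forall_eq_or (K := K) (m := m) (θ := θ)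
    hij hik hil hjk hjl hkl hall
  have hprod {w : PolyS K} (h₁ : braidForm K j i ^ m s(i, j) ∣ w)
      (h₂ : braidForm K k i ^ m s(i, k) ∣ w) (h₃ : braidForm K l i ^ m s(i, l) ∣ w) :
      braidForm K j i ^ m s(i, j) * braidForm K k i ^ m s(i, k) * braidForm K l i ^ m s(i, l) ∣ w := by
    obtain ⟨w, rfl⟩ := h₁
    obtain ⟨w, rfl⟩ := (prime_braidForm hik.symm).pow_dvd_of_dvd_mul_left _ (fun hd =>
      not_braidForm_dvd hij.symm hjk hik ((prime_braidForm hik.symm).dvd_of_dvd_pow hd)) h₂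
    rw [← mul_assoc] at h₃ ⊢
    refine mul_dvd_mul_left _ ((prime_braidForm hil.symm).pow_dvd_of_dvd_mul_left _ (fun hd => ?_) h₃)
    rcases (prime_braidForm hil.symm).dvd_or_dvd hd with hd | hd
    · exact not_braidForm_dvd hij.symm hjl hil ((prime_braidForm hil.symm).dvd_of_dvd_pow hd)
    · exact not_braidForm_dvd hik.symm hkl hil ((prime_braidForm hil.symm).dvd_of_dvd_pow hd)
  have hsub : braidForm K k l = braidForm K j l - braidForm K j k := by
    simp only [braidForm]; ring
  obtain ⟨v₁, v₂, e₁, e₂, r₁, r₂, hv⟩ := IsSyzygyBasis.exists_basis (K := K)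
    (X := braidForm K j k) (prime_braidForm (K := K) hjl)
    (fun hd => not_braidForm_dvd (K := K) hjk hjl hkl (by rwa [braidForm_swap j l, neg_dvd]))
    (pow_ne_zero (m s(j, k)) (braidForm_ne_zero hjk))
    (pow_ne_zero (m s(k, l)) (braidForm_ne_zero hkl))
    (IsBinaryForm.left_pow (m s(j, k)))
    (b := m s(k, l)) (by rw [hsub]; exact IsBinaryForm.sub_pow _) (m s(j, l))
  have hlift (v : PolyS K × PolyS K) (h₁ : braidForm K j k ^ m s(j, k) ∣ v.1)
      (h₂ : braidForm K k l ^ m s(k, l) ∣ v.2) (h₃ : braidForm K j l ^ m s(j, l) ∣ v.1 + v.2) :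
      ∃ θ : logDerivations K m, θ.1 (X i) = 0 ∧ θ.1 (X j) - θ.1 (X k) = v.1 ∧
        θ.1 (X k) - θ.1 (X l) = v.2 := by
    -- The differences fix the values at `x_j`, `x_k`, `x_l` as `v.1 + v.2`, `v.2`, `0` up to a
    -- common shift `c`, which must satisfy the conditions on the edges at `i` with value `0` at
    -- `x_i`.
    obtain ⟨c, hc₁, hc₂, hc₃⟩ := exists_dvd_sub_of_pairwise_mem_span
      (p := braidForm K j i ^ m s(i, j)) (q := braidForm K k i ^ m s(i, k))
      (r := braidForm K l i ^ m s(i, l)) (f := v.1 + v.2) (g := v.2) (h := 0)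
      (fun w hw => mem_span_pair_of_braidForm_pow_mul_mem
        (by rw [map_pow, collapse_braidForm_of_ne hjk.symm hij])
        (by rw [map_pow, collapse_braidForm_of_ne hjl.symm hij]) _ w hw hij.symm)
      (Ideal.mem_of_dvd _ (by simpa using h₁) (braidForm_pow_mem_span_pair hjk'))
      (Ideal.mem_of_dvd _ (by simpa using h₃) (braidForm_pow_mem_span_pair hjl'))
      (Ideal.mem_of_dvd _ (by simpa using h₂) (braidForm_pow_mem_span_pair hkl'))
    set θ : Derivation K (PolyS K) (PolyS K) := mkDerivation K fun x =>
      if x = i then 0 else if x = j then v.1 + v.2 - c else if x = k then v.2 - c else 0 - c with hθ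
    have hθi : θ (X i) = 0 := by simp [hθ]
    have hθj : θ (X j) = v.1 + v.2 - c := by simp [hθ, hij.symm]
    have hθk : θ (X k) = v.2 - c := by simp [hθ, hik.symm, hjk.symm]
    have hθl : θ (X l) = 0 - c := by simp [hθ, hil.symm, hjl.symm, hkl.symm]
    refine ⟨⟨θ, (hmem θ).mpr ?_⟩, hθi, ?_, ?_⟩
    · rw [hθi, hθj, hθk, hθl]
      simp only [sub_zero]
      exact ⟨hc₁, hc₂, hc₃, by simpa using h₁, by simpa using h₂, by simpa using h₃⟩
    · simp only [hθj, hθk]; ring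
    · simp only [hθk, hθl]; ring
  obtain ⟨θ₁, hθ₁, hθ₁', hθ₁''⟩ := hlift v₁ hv.dvd₁.1 hv.dvd₁.2 ⟨r₁, hv.sum₁⟩
  obtain ⟨θ₂, hθ₂, hθ₂', hθ₂''⟩ := hlift v₂ hv.dvd₂.1 hv.dvd₂.2 ⟨r₂, hv.sum₂⟩
  set P :=
    braidForm K j i ^ m s(i, j) * braidForm K k i ^ m s(i, k) * braidForm K l i ^ m s(i, l)

  have hP₀ : P ≠ 0 := mul_ne_zero (mul_ne_zero (pow_ne_zero _ (braidForm_ne_zero hij.symm))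
    (pow_ne_zero _ (braidForm_ne_zero hik.symm))) (pow_ne_zero _ (braidForm_ne_zero hil.symm))
  -- `η₀` and `η₁` generate the derivations that agree on `x_j`, `x_k`, `x_l`.
  let η₀ : logDerivations K m := ⟨mkDerivation K fun _ => 1, by rw [hmem]; simp⟩
  let η₁ : logDerivations K m := ⟨mkDerivation K fun x => if x = i then 0 else P, by
    rw [hmem]
    simp only [mkDerivation_X, hij.symm, hik.symm, hil.symm, if_true, if_false, sub_self, sub_zero,
      dvd_zero, and_true]
    exact ⟨(dvd_mul_right _ _).mul_right _, (dvd_mul_left _ _).mul_right _, dvd_mul_left _ _⟩⟩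
  have hη₀ (x : Fin 4) : η₀.1 (X x) = 1 := by simp [η₀]
  have hη₁i : η₁.1 (X i) = 0 := by simp [η₁]
  have hη₁ {x : Fin 4} (hx : x ≠ i) : η₁.1 (X x) = P := by simp [η₁, hx]
  refine Module.Free.of_four_generators η₀ η₁ θ₁ θ₂ ?_ ?_
  · intro g₀ g₁ g₂ g₃ hg
    have hval (x : Fin 4) : g₀ * η₀.1 (X x) + g₁ * η₁.1 (X x) + g₂ * θ₁.1 (X x) +
        g₃ * θ₂.1 (X x) = 0 :=
      congrArg (fun θ : logDerivations K m => θ.1 (X x)) hg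
    have hi := hval i
    have hj := hval j
    have hk := hval k
    have hl := hval l
    rw [hη₀, hη₁ hij.symm] at hj
    rw [hη₀, hη₁ hik.symm] at hk
    rw [hη₀, hη₁ hil.symm] at hl
    rw [hη₀, hη₁i, hθ₁, hθ₂] at hi
    obtain ⟨h₂, h₃⟩ := hv.indep g₂ g₃ (by
      ext1
      · simp only [Prod.fst_add, Prod.smul_fst, smul_eq_mul, Prod.fst_zero, ← hθ₁', ← hθ₂']
        linear_combination hj - hk
      · simp only [Prod.snd_add, Prod.smul_snd, smul_eq_mul, Prod.snd_zero, ← hθ₁'', ← hθ₂'']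
        linear_combination hk - hl)
    have h₀ : g₀ = 0 := by linear_combination hi
    have h₁ : g₁ = 0 := by
      rw [h₀, h₂, h₃] at hj
      simpa [hP₀] using hj
    exact ⟨h₀, h₁, h₂, h₃⟩
  · intro θ
    obtain ⟨d₁, d₂, d₃, d₄, d₅, d₆⟩ := (hmem θ.1).mp θ.2
    obtain ⟨x, y, hxy⟩ := hv.span (θ.1 (X j) - θ.1 (X k), θ.1 (X k) - θ.1 (X l)) d₄ d₅
      (by simpa using d₆)
    obtain ⟨hxy₁, hxy₂⟩ := Prod.ext_iff.mp hxy
    simp only [Prod.fst_add, Prod.smul_fst, Prod.snd_add, Prod.smul_snd, smul_eq_mul, ← hθ₁',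
      ← hθ₂', ← hθ₁'', ← hθ₂''] at hxy₁ hxy₂
    -- `ψ` agrees on `x_j`, `x_k`, `x_l`, so its common difference from `ψ(x_i)` is divisible by
    -- three coprime powers, hence by `P`.
    set ψ : logDerivations K m := θ - x • θ₁ - y • θ₂ with hψ
    obtain ⟨f₁, f₂, f₃, -⟩ := (hmem ψ.1).mp ψ.2
    have hψv (z : Fin 4) : ψ.1 (X z) = θ.1 (X z) - x * θ₁.1 (X z) - y * θ₂.1 (X z) := by
      simp [hψ]
    have hk : ψ.1 (X k) = ψ.1 (X j) := by
      rw [hψv, hψv]; linear_combination -hxy₁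
    have hl : ψ.1 (X l) = ψ.1 (X j) := by
      rw [hψv, hψv]; linear_combination -hxy₁ - hxy₂
    rw [hk] at f₂
    rw [hl] at f₃
    obtain ⟨w, hw⟩ := hprod f₁ f₂ f₃
    have hfin : θ = ψ.1 (X i) • η₀ + w • η₁ + x • θ₁ + y • θ₂ := by
      have : ψ = ψ.1 (X i) • η₀ + w • η₁ := by
        apply Subtype.ext
        apply MvPolynomial.derivation_ext
        intro z
        have hz : (ψ.1 (X i) • η₀ + w • η₁ : logDerivations K m).1 (X z) =
            ψ.1 (X i) * η₀.1 (X z) + w * η₁.1 (X z) := by simp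
        rw [hz, hη₀]
        rcases hall z with rfl | rfl | rfl | rfl
        · rw [hη₁i]; ring
        · rw [hη₁ hij.symm]; linear_combination hw
        · rw [hη₁ hik.symm]; linear_combination hw + hk
        · rw [hη₁ hil.symm]; linear_combination hw + hl
      rw [← this, hψ]
      abel
    exact ⟨_, _, _, _, hfin⟩

end Freeness

/-! ### Minimal generation and free vertices -/

section MinimalGeneration

open MvPolynomial

variable {K : Type*} [Field K] {m : Sym2 (Fin 4) → ℕ}

theorem braidForm_pow_mem_powerIdeal {E : Set (Sym2 (Fin 4))} {i j : Fin 4} (hij : i ≠ j)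
    (h : s(i, j) ∈ E) : braidForm K i j ^ m s(i, j) ∈ powerIdeal K m E := by
  rcases lt_or_gt_of_ne hij with hlt | hlt
  · exact Ideal.subset_span ⟨i, j, hlt, h, rfl⟩
  · rw [Sym2.eq_swap] at h ⊢
    exact Ideal.mem_of_dvd _ (associated_braidForm_pow_swap i j _).dvd
      (Ideal.subset_span ⟨j, i, hlt, h, rfl⟩)

theorem powerIdeal_le_iff {E : Set (Sym2 (Fin 4))} {I : Ideal (PolyS K)} :
    powerIdeal K m E ≤ I ↔
      ∀ i j : Fin 4, i ≠ j → s(i, j) ∈ E → braidForm K i j ^ m s(i, j) ∈ I := by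
  refine ⟨fun h i j hij hE => h (braidForm_pow_mem_powerIdeal hij hE), fun h => ?_⟩
  rw [powerIdeal, Ideal.span_le]
  rintro - ⟨i, j, hij, hE, rfl⟩
  exact h i j hij.ne hE

theorem powerIdeal_mono {E F : Set (Sym2 (Fin 4))} (h : E ⊆ F) :
    powerIdeal K m E ≤ powerIdeal K m F :=
  powerIdeal_le_iff.mpr fun _ _ hij hE => braidForm_pow_mem_powerIdeal hij (h hE)

theorem powerIdeal_incidenceSet_le_iff {i : Fin 4} {I : Ideal (PolyS K)} :
    powerIdeal K m ((⊤ : SimpleGraph (Fin 4)).incidenceSet i) ≤ I ↔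
      ∀ j : Fin 4, j ≠ i → braidForm K j i ^ m s(i, j) ∈ I := by
  rw [powerIdeal_le_iff]
  constructor
  · intro h j hj
    rw [Sym2.eq_swap]
    exact h j i hj (by simp [SimpleGraph.incidenceSet, hj])
  · rintro h j k hjk ⟨-, hi⟩
    rcases Sym2.mem_iff.mp hi with rfl | rfl
    · exact Ideal.mem_of_dvd _ (associated_braidForm_pow_swap i k _).dvd (h k hjk.symm)
    · rw [Sym2.eq_swap]
      exact h j hjk

/-- In two variables `s, t` over a field of characteristic zero, `(s - t) ^ n ∈ ⟨s ^ a, t ^ b⟩` with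
`a, b > 0` forces `a + b ≤ n + 1`. -/
theorem Polynomial.add_le_of_X_sub_C_pow_mem [CharZero K] {a b n : ℕ} (ha : 0 < a) (hb : 0 < b)
    (h : ((Polynomial.X - Polynomial.C Polynomial.X) ^ n : Polynomial (Polynomial K)) ∈
      Ideal.span {Polynomial.X ^ a, Polynomial.C Polynomial.X ^ b}) : a + b ≤ n + 1 := by
  by_contra! hlt
  obtain ⟨d, rfl⟩ := Nat.exists_eq_add_of_le' ha
  obtain ⟨e, rfl⟩ := Nat.exists_eq_add_of_le' hb
  have hn : n ≤ d + e := by omega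
  -- Raise the exponent to exactly `d + e = a + b - 2`. The monomial `s ^ (a - 1) t ^ (b - 1)` then
  -- has coefficient `±(d + e).choose d`, but it occurs in no element of the ideal.
  have h' := Ideal.mul_mem_left _
    ((Polynomial.X - Polynomial.C Polynomial.X) ^ (d + e - n) : Polynomial (Polynomial K)) h
  rw [← pow_add, Nat.sub_add_cancel hn, Ideal.mem_span_pair] at h'
  obtain ⟨y, z, hyz⟩ := h'
  have h₁ := congrArg (fun p => (p.coeff d).coeff e) hyz
  simp only [Polynomial.coeff_add, Polynomial.coeff_mul_X_pow', ← Polynomial.C_pow,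
    Polynomial.coeff_mul_C, sub_eq_add_neg, ← Polynomial.C_neg, Polynomial.coeff_X_add_C_pow,
    Nat.add_sub_cancel_left] at h₁
  rw [if_neg (by omega), Polynomial.coeff_zero, if_neg (by omega), neg_pow] at h₁
  have e₁ : ((-1) ^ e * Polynomial.X ^ e * ((d + e).choose d : Polynomial K)) =
      Polynomial.C ((-1) ^ e * ((d + e).choose d : K)) * Polynomial.X ^ e := by
    simp only [map_mul, map_pow, map_neg, map_one, map_natCast]
    ring
  rw [e₁, Polynomial.coeff_C_mul_X_pow, if_pos rfl, zero_add] at h₁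
  have hc : ((d + e).choose d : K) ≠ 0 :=
    Nat.cast_ne_zero.mpr (Nat.choose_pos (Nat.le_add_right d e)).ne'
  exact mul_ne_zero (pow_ne_zero e (neg_ne_zero.mpr one_ne_zero)) hc h₁.symm

theorem isFreeVertex_of_powerIdeal_eq [CharZero K] {i : Fin 4}
    (hpos : ∀ j, j ≠ i → 0 < m s(i, j))
    (h : powerIdeal K m ((⊤ : SimpleGraph (Fin 4)).incidenceSet i) = idealJ0123 K m) :
    IsFreeVertex m i := by
  intro j k hj hk hjk
  have hmem : braidForm K j k ^ m s(j, k) ∈ idealJ0123 K m :=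
    braidForm_pow_mem_powerIdeal hjk (by simpa using hjk)
  -- Setting `x_i` and the fourth variable to zero leaves two variables; the power on the remaining
  -- edge at `i` vanishes because its exponent is positive.
  let φ : PolyS K →ₐ[K] Polynomial (Polynomial K) := aeval fun x =>
    if x = j then Polynomial.X else if x = k then Polynomial.C Polynomial.X else 0
  have hφi : φ (X i) = 0 := by simp [φ, hj.symm, hk.symm]
  have hφj : φ (X j) = Polynomial.X := by simp [φ]
  have hφk : φ (X k) = Polynomial.C Polynomial.X := by simp [φ, hjk.symm]
  have hle : idealJ0123 K m ≤ Ideal.comap φ.toRingHom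
      (Ideal.span {Polynomial.X ^ m s(i, j), Polynomial.C Polynomial.X ^ m s(i, k)}) := by
    rw [← h, powerIdeal_incidenceSet_le_iff]
    intro l hl
    change φ (braidForm K l i ^ m s(i, l)) ∈
      Ideal.span {Polynomial.X ^ m s(i, j), Polynomial.C Polynomial.X ^ m s(i, k)}
    rw [braidForm, map_pow, map_sub, hφi, sub_zero]
    by_cases hlj : l = j
    · subst hlj
      rw [hφj]
      exact Ideal.subset_span (by simp)
    by_cases hlk : l = k
    · subst hlk
      rw [hφk]
      exact Ideal.subset_span (by simp)
    have hφl : φ (X l) = 0 := by simp [φ, hlj, hlk]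
    rw [hφl, zero_pow (hpos l hl).ne']
    exact Ideal.zero_mem _
  have := hle hmem
  change φ (braidForm K j k ^ m s(j, k)) ∈
    Ideal.span {Polynomial.X ^ m s(i, j), Polynomial.C Polynomial.X ^ m s(i, k)} at this
  rw [braidForm, map_pow, map_sub, hφj, hφk] at this
  exact Polynomial.add_le_of_X_sub_C_pow_mem (hpos j hj) (hpos k hk) this

/-- A zero exponent makes one edge generate the unit ideal by itself, so the other edges at `i`
would be redundant. -/
theorem IsMinimallyGeneratedAt.pos {i : Fin 4} (h : IsMinimallyGeneratedAt K m i) (j : Fin 4)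
    (hj : j ≠ i) : 0 < m s(i, j) := by
  by_contra! h₀
  have htop : powerIdeal K m {s(i, j)} = ⊤ := by
    rw [Ideal.eq_top_iff_one]
    simpa [Nat.le_zero.mp h₀] using
      braidForm_pow_mem_powerIdeal (K := K) (m := m) hj.symm (Set.mem_singleton s(i, j))
  have hJ : powerIdeal K m {s(i, j)} = idealJ0123 K m := by
    rw [htop, eq_comm, ← top_le_iff, ← htop]
    exact powerIdeal_mono (by simpa using hj.symm)
  have hsub := h.2 hJ (by simp [SimpleGraph.incidenceSet, hj.symm])
  obtain ⟨k, hk, hkj⟩ : ∃ k : Fin 4, k ≠ i ∧ k ≠ j :=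
    (by decide : ∀ i j : Fin 4, ∃ k : Fin 4, k ≠ i ∧ k ≠ j) i j
  have := hsub (show s(i, k) ∈ _ by simp [SimpleGraph.incidenceSet, hk.symm])
  rw [Set.mem_singleton_iff, Sym2.congr_right] at this
  exact hkj this

theorem IsFreeVertex.isMinimallyGeneratedAt {i : Fin 4} (h : IsFreeVertex m i)
    (hpos : ∀ j, j ≠ i → 0 < m s(i, j)) : IsMinimallyGeneratedAt K m i := by
  refine ⟨le_antisymm (powerIdeal_mono (SimpleGraph.incidenceSet_subset _ _))
    (powerIdeal_le_iff.mpr fun j k hjk _ => ?_), fun E hE hsub => ?_⟩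
  · have hinc := powerIdeal_incidenceSet_le_iff (K := K) (m := m) (i := i).mp le_rfl
    by_cases hj : j = i
    · subst hj
      exact braidForm_pow_mem_powerIdeal hjk (by simp [SimpleGraph.incidenceSet, hjk])
    by_cases hk : k = i
    · subst hk
      exact braidForm_pow_mem_powerIdeal hjk (by simp [SimpleGraph.incidenceSet, hjk])
    refine Ideal.span_le.mpr ?_ (braidForm_pow_mem_span_pair (i := i) (h j k hj hk hjk))
    rintro - (rfl | rfl)
    exacts [hinc j hj, hinc k hk]
  · intro e he
    by_contra heE
    obtain ⟨k, rfl⟩ := Sym2.mem_iff_exists.mp he.2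
    have hki : k ≠ i := by
      rintro rfl
      simpa using he.1
    -- Keeping only `x_k` kills every generator on an edge at `i` other than `ik`, but not the power
    -- on `ik`, so `ik` cannot be dropped.
    let φ : PolyS K →ₐ[K] Polynomial K := aeval fun x => if x = k then Polynomial.X else 0
    have hφ {x : Fin 4} (hx : x ≠ k) : φ (X x) = 0 := by simp [φ, hx]
    have hle : idealJ0123 K m ≤ (⊥ : Ideal (Polynomial K)).comap φ.toRingHom := by
      change powerIdeal K m E = _ at hE
      rw [← hE, powerIdeal_le_iff]
      intro x y hxy hxyE
      change φ (braidForm K x y ^ m s(x, y)) = 0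
      have hpos' : 0 < m s(x, y) := by
        rcases Sym2.mem_iff.mp (hsub hxyE).2 with rfl | rfl
        · exact hpos y hxy.symm
        · rw [Sym2.eq_swap]; exact hpos x hxy
      have hx : x ≠ k := by
        rintro rfl
        rcases Sym2.mem_iff.mp (hsub hxyE).2 with rfl | rfl
        · exact hki rfl
        · exact heE (by rwa [Sym2.eq_swap])
      have hy : y ≠ k := by
        rintro rfl
        rcases Sym2.mem_iff.mp (hsub hxyE).2 with rfl | rfl
        · exact heE hxyE
        · exact hki rfl
      rw [braidForm, map_pow, map_sub, hφ hx, hφ hy, sub_zero, zero_pow hpos'.ne']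
    have hmem : braidForm K k i ^ m s(k, i) ∈ idealJ0123 K m :=
      braidForm_pow_mem_powerIdeal hki (by simpa using hki)
    have := hle hmem
    change φ (braidForm K k i ^ m s(k, i)) = 0 at this
    rw [braidForm, map_pow, map_sub, hφ hki.symm, sub_zero] at this
    simp [φ] at this

theorem IsMinimallyGeneratedAt.isFreeVertex [CharZero K] {i : Fin 4}
    (h : IsMinimallyGeneratedAt K m i) : IsFreeVertex m i :=
  isFreeVertex_of_powerIdeal_eq h.pos h.1

end MinimalGeneration

theorem mainTheorem11 (K : Type*) [Field K] [CharZero K] (m : Sym2 (Fin 4) → ℕ) :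
    (∀ i : Fin 4, IsMinimallyGeneratedAt K m i → IsFreeMultiplicity K m) ∧
    (∀ i : Fin 4, IsFreeVertex m i → IsFreeMultiplicity K m) ∧
    ((∀ e ∈ (⊤ : SimpleGraph (Fin 4)).edgeSet, 0 < m e) →
      ∀ i : Fin 4, IsMinimallyGeneratedAt K m i ↔ IsFreeVertex m i) :=
  ⟨fun _ h => h.isFreeVertex.isFreeMultiplicity, fun _ h => h.isFreeMultiplicity,
    fun hpos _ => ⟨fun h => h.isFreeVertex,
      fun h => h.isMinimallyGeneratedAt fun _ hj => hpos _ (by simpa using hj.symm)⟩⟩
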